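/- Let $\mathbf{Prop}$ be a set of propositional letters. The basic language is $\varphi ::= \bot \mid p \mid \neg\varphi \mid \varphi\lor\varphi \mid \langle\cdot\rangle\varphi\varphi$ with $p\in\mathbf{Prop}$ and a binary modality $\langle\cdot\rangle$; the extended language has in addition a binary connective $\varphi\backslash\varphi$. Let $(P,\le)$ be a preorder and $s,t,u\in P$. Call $s$ a (quasi-)minimal upper bound of $\{t,u\}$ if $s$ is an upper bound of $\{t,u\}$ and every upper bound $x$ of $\{t,u\}$ with $x\le s$ also satisfies $s\le x$; call $s$ a (quasi-)least upper bound of $\{t,u\}$ if $s$ is an upper bound of $\{t,u\}$ and $s\le x$ for every upper bound $x$ of $\{t,u\}$. Write $R\,s\,tu$ for the first relation (the minimal reading, $\mathrm{mub}$) or for the second (the least reading, $\sup$). Given a valuation $V:\mathbf{Prop}\to\mathcal P(P)$, satisfaction at a point is defined by the usual clauses for $\bot,p,\neg,\lor$ and by - $s\Vdash\langle\cdot\rangle\varphi\psi$ iff there are $t,u\in P$ with $t\Vdash\varphi$, $u\Vdash\psi$ and $R\,s\,tu$; - $u\Vdash\varphi\backslash\psi$ iff for all $t,s\in P$, if $t\Vdash\varphi$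 and $R\,s\,tu$, then $s\Vdash\psi$. A formula is valid over a class of frames if it holds at every point of every model on a frame in the class; it is a consequence of a set $\Gamma$ of formulas over the class if it holds at every point, of every model on a frame in the class, at which all members of $\Gamma$ hold. Let $\mathbf{MIN}_{Pos}$, $\mathbf{MIN}_{Pre}$ be the logics (the validities together with the consequence relation) of the basic language under the minimal reading over all posets and over all preorders, respectively; let $\mathbf{MIL}_{Pos}$, $\mathbf{MIL}_{Pre}$ be the logics under the least reading over the same classes; and write $(\backslash)$ for the corresponding logics of the extended language. Then $$\mathbf{MIN}_{Pos}=\mathbf{MIN}_{Pre}=\mathbf{MIL}_{Pre}=\mathbf{MIL}_{Pos}$$ and $$\mathbf{MIN}_{Pos}(\backslash)=\mathbf{MIN}_{Pre}(\backslash)=\mathbf{MIL}_{Pre}(\backslash)=\mathbf{MIL}_{Pos}(\backslash).$$ In each chain the equalities hold both for the sets of validities and for the consequence relations. -/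

import Mathlib

universe u v

namespace ModalUB

/-- The basic language: `fus φ ψ` is the binary modality written `⟨mub⟩φψ` or `⟨sup⟩φψ`. -/
inductive Formula (α : Type v) : Type v where
  | bot : Formula α
  | var : α → Formula α
  | neg : Formula α → Formula α
  | or : Formula α → Formula α → Formula α
  | fus : Formula α → Formula α → Formula α

/-- The language enriched with the residual implication: `res φ ψ` is `φ \ ψ`. -/
inductive ResFormula (α : Type v) : Type v where
  | bot : ResFormula α
  | var : α → ResFormula α
  | neg : ResFormula α → ResFormula α
  | or : ResFormula α → ResFormula α → ResFormula α
  | fus : ResFormula α → ResFormula α → ResFormula α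
  | res : ResFormula α → ResFormula α → ResFormula α

/-- `s` is a (quasi-)minimal upper bound of `{t, u}`: an upper bound such that no upper bound is
strictly below it, i.e. every upper bound `x ≤ s` also satisfies `s ≤ x`. -/
def IsMub {P : Type u} [Preorder P] (s t u : P) : Prop :=
  Minimal (fun x => x ∈ upperBounds {t, u}) s

/-- `s` is a (quasi-)least upper bound of `{t, u}`; unique when `P` is a poset. -/
def IsSup {P : Type u} [Preorder P] (s t u : P) : Prop :=
  IsLUB {t, u} s

/-- The two readings of the modality. -/
inductive Reading where
  | mub
  | sup

/-- The ternary relation `s ∈ mub{t, u}`, respectively `s = sup{t, u}`. -/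
def Reading.Rel (I : Reading) {P : Type u} [Preorder P] (s t u : P) : Prop :=
  match I with
  | .mub => IsMub s t u
  | .sup => IsSup s t u

/-- Satisfaction at a point, under the reading `I` and the valuation `V`. -/
def Formula.Sat {α : Type v} (I : Reading) {P : Type u} [Preorder P] (V : α → Set P) :
    P → Formula α → Prop
  | _, .bot => False
  | s, .var p => s ∈ V p
  | s, .neg φ => ¬ Formula.Sat I V s φ
  | s, .or φ ψ => Formula.Sat I V s φ ∨ Formula.Sat I V s ψ
  | s, .fus φ ψ => ∃ t u : P, Formula.Sat I V t φ ∧ Formula.Sat I V u ψ ∧ I.Rel s t u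

/-- Satisfaction at a point for the enriched language. -/
def ResFormula.Sat {α : Type v} (I : Reading) {P : Type u} [Preorder P] (V : α → Set P) :
    P → ResFormula α → Prop
  | _, .bot => False
  | s, .var p => s ∈ V p
  | s, .neg φ => ¬ ResFormula.Sat I V s φ
  | s, .or φ ψ => ResFormula.Sat I V s φ ∨ ResFormula.Sat I V s ψ
  | s, .fus φ ψ => ∃ t u : P, ResFormula.Sat I V t φ ∧ ResFormula.Sat I V u ψ ∧ I.Rel s t u
  | u, .res φ ψ => ∀ t s : P, ResFormula.Sat I V t φ → I.Rel s t u → ResFormula.Sat I V s ψ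

/-- The two classes of frames. -/
inductive FrameClass where
  | pos
  | pre

/-- All preorders, respectively the antisymmetric ones (posets). -/
def FrameClass.Mem (K : FrameClass) (P : Type u) [Preorder P] : Prop :=
  match K with
  | .pos => ∀ x y : P, x ≤ y → y ≤ x → x = y
  | .pre => True

/-- A logic in a language: its validities together with its consequence relation. -/
structure Logic (F : Type v) where
  validities : Set F
  consequence : Set F → F → Prop

/-- The logic of the frame class `K` (frames with carrier in `Type u`) under the reading `I`:
validity at all points of all models, and (local) consequence from arbitrary sets of premises. -/
def logicOf {α : Type v} (I : Reading) (K : FrameClass) : Logic (Formula α) where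
  validities := {φ | ∀ (P : Type u) [Preorder P], K.Mem P →
    ∀ (V : α → Set P) (s : P), Formula.Sat I V s φ}
  consequence Γ φ := ∀ (P : Type u) [Preorder P], K.Mem P →
    ∀ (V : α → Set P) (s : P), (∀ γ ∈ Γ, Formula.Sat I V s γ) → Formula.Sat I V s φ

/-- The same for the language with the residual implication. -/
def resLogicOf {α : Type v} (I : Reading) (K : FrameClass) : Logic (ResFormula α) where
  validities := {φ | ∀ (P : Type u) [Preorder P], K.Mem P →
    ∀ (V : α → Set P) (s : P), ResFormula.Sat I V s φ}
  consequence Γ φ := ∀ (P : Type u) [Preorder P], K.Mem P →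
    ∀ (V : α → Set P) (s : P), (∀ γ ∈ Γ, ResFormula.Sat I V s γ) → ResFormula.Sat I V s φ

def MINPos (α : Type v) : Logic (Formula α) := logicOf.{u, v} .mub .pos
def MINPre (α : Type v) : Logic (Formula α) := logicOf.{u, v} .mub .pre
def MILPos (α : Type v) : Logic (Formula α) := logicOf.{u, v} .sup .pos
def MILPre (α : Type v) : Logic (Formula α) := logicOf.{u, v} .sup .pre

/-! The logics of the language with the residual implication. -/

def MINPosRes (α : Type v) : Logic (ResFormula α) := resLogicOf.{u, v} .mub .pos
def MINPreRes (α : Type v) : Logic (ResFormula α) := resLogicOf.{u, v} .mub .pre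
def MILPosRes (α : Type v) : Logic (ResFormula α) := resLogicOf.{u, v} .sup .pos
def MILPreRes (α : Type v) : Logic (ResFormula α) := resLogicOf.{u, v} .sup .pre

end ModalUB

/-! Every pointed preorder model, under either reading, has the same theory as a pointed poset model
under either reading. The reason is a representation (`IsFusion.exists_poset`): for a fusion
relation `R` on `W` there is a poset `Q` and a map `f : Q → W` such that every minimal upper bound
in `Q` maps into `R`, while every `R`-triple at a point of `Q` lifts to an actual supremum. Suprema
are minimal upper bounds, so `f` is a bounded morphism for both readings at once.

`Q` is a maximal network. A triple is realised by inserting two points below `q` with supremum `q`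
(fork), or a point beside `u` together with their supremum (join). If `q` bounds `x` and `y`
although `R` fails on the labels, a smaller upper bound is inserted below `q` (mid). The invariant
`Network.fusion` keeps these moves compatible: an upper bound in the lower set generated by `x` and
`y` has labels in `R`. Nodes are terms naming the request they serve, so all networks live on one
type, unions of chains are networks, and Zorn's lemma yields one where every request is served. -/

namespace ModalUB

/-! ### Fusion relations: what the two readings have in common -/

/-- The properties of `IsMub` and `IsSup` on a preorder on which the representation rests. -/
structure IsFusion {W : Type u} [Preorder W] (R : W → W → W → Prop) : Prop where
  symm : ∀ {s t u}, R s t u → R s u t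
  le_left : ∀ {s t u}, R s t u → t ≤ s
  of_le : ∀ {s t}, t ≤ s → R s s t

theorem IsFusion.le_right {W : Type u} [Preorder W] {R : W → W → W → Prop} (hR : IsFusion R)
    {s t u : W} (h : R s t u) : u ≤ s :=
  hR.le_left (hR.symm h)

theorem IsSup.isMub {P : Type u} [Preorder P] {s t u : P} (h : IsSup s t u) : IsMub s t u :=
  ⟨h.1, fun _ hx _ => h.2 hx⟩

theorem Reading.isFusion (I : Reading) (P : Type u) [Preorder P] :
    IsFusion (I.Rel (P := P)) where
  symm {s t u} h := by
    cases I <;> simpa only [Reading.Rel, IsMub, IsSup, Set.pair_comm] using h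
  le_left {s t u} h := by
    cases I
    · exact h.1 (Set.mem_insert _ _)
    · exact h.1 (Set.mem_insert _ _)
  of_le {s t} h := by
    have hsup : IsSup s s t := by
      refine ⟨?_, fun x hx => hx (Set.mem_insert _ _)⟩
      rintro x (rfl | rfl)
      · exact le_rfl
      · exact h
    cases I
    · exact hsup.isMub
    · exact hsup

/-! ### Formal nodes and the lower sets they generate -/

/-- Names for the points of the poset representing a ternary relation on `W`: `left q t u` and
`right q t u` have supremum `q`; `join u s t` is the supremum of `side u s t` and `u`; and
`mid q x y` is an upper bound of `x` and `y` strictly below `q`. -/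
inductive Node (W : Type u) : Type u where
  | base : W → Node W
  | left : Node W → W → W → Node W
  | right : Node W → W → W → Node W
  | join : Node W → W → W → Node W
  | side : Node W → W → W → Node W
  | mid : Node W → Node W → Node W → Node W

namespace Node

variable {W : Type u}

/-- The point of `W` represented by a node. -/
def lab : Node W → W
  | base w => w
  | left _ t _ => t
  | right _ _ u => u
  | join _ s _ => s
  | side _ _ t => t
  | mid q _ _ => lab q

theorem mid_ne (q x y : Node W) : mid q x y ≠ q := by
  intro h
  have := congrArg sizeOf h
  simp only [mid.sizeOf_spec] at this
  omega

/-- `Triple q a b`: the node `q` is to be the supremum of `a` and `b`. -/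
inductive Triple : Node W → Node W → Node W → Prop where
  | fork (q : Node W) (t u : W) : Triple q (left q t u) (right q t u)
  | join (u : Node W) (s t : W) : Triple (join u s t) (side u s t) u

/-- The lower set generated by `x` and `y` under `r` and the designated suprema. -/
inductive Cl (r : Node W → Node W → Prop) (x y : Node W) : Node W → Prop where
  | fst : Cl r x y x
  | snd : Cl r x y y
  | down {z z' : Node W} : r z z' → Cl r x y z' → Cl r x y z
  | triple {q a b : Node W} : Triple q a b → Cl r x y a → Cl r x y b → Cl r x y q

theorem Cl.symm {r : Node W → Node W → Prop} {x y z : Node W} (h : Cl r x y z) : Cl r y x z := by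
  induction h with
  | fst => exact .snd
  | snd => exact .fst
  | down h _ ih => exact .down h ih
  | triple h _ _ iha ihb => exact .triple h iha ihb

theorem Cl.mono {r r' : Node W → Node W → Prop} (hr : r ≤ r') {x y z : Node W}
    (h : Cl r x y z) : Cl r' x y z := by
  induction h with
  | fst => exact .fst
  | snd => exact .snd
  | down h _ ih => exact .down (hr _ _ h) ih
  | triple h _ _ iha ihb => exact .triple h iha ihb

end Node

open Node

/-! ### Networks and unions of chains -/

/-- `r` is a partial order on its domain `{x | r x x}`, a set of nodes, in which the designated
suprema are suprema and generate only what `R` allows. -/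
structure Network {W : Type u} [Preorder W] (R : W → W → W → Prop)
    (r : Node W → Node W → Prop) : Prop where
  dom_left : ∀ {x y}, r x y → r x x
  dom_right : ∀ {x y}, r x y → r y y
  trans : ∀ {x y z}, r x y → r y z → r x z
  antisymm : ∀ {x y}, r x y → r y x → x = y
  lab_mono : ∀ {x y}, r x y → lab x ≤ lab y
  fork : ∀ {q t u}, r (left q t u) (left q t u) ∨ r (right q t u) (right q t u) →
    r (left q t u) q ∧ r (right q t u) q
  join : ∀ {u s t}, r (side u s t) (side u s t) ∨ r (join u s t) (join u s t) →
    r (side u s t) (join u s t) ∧ r u (join u s t)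
  mid : ∀ {q x y}, r (mid q x y) (mid q x y) →
    r x (mid q x y) ∧ r y (mid q x y) ∧ r (mid q x y) q
  closed : ∀ {q a b x}, Triple q a b → r a x → r b x → r q x
  -- By `closed`, such a `z` lies below every common upper bound of `x` and `y`, in this and in
  -- every larger network. It can therefore never stop being their supremum, and `R` must already
  -- hold.
  fusion : ∀ {x y z}, Cl r x y z → r x z → r y z → R (lab z) (lab x) (lab y)

namespace Network

variable {W : Type u} [Preorder W] {R : W → W → W → Prop} {r : Node W → Node W → Prop}

theorem triple_dom (hr : Network R r) {q a b : Node W} (h : Triple q a b) (ha : r a a) :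
    r a q ∧ r b q := by
  cases h with
  | fork t u => exact hr.fork (.inl ha)
  | join s t => exact hr.join (.inl ha)

theorem le_of_cl (hr : Network R r) {x y z w : Node W} (h : Cl r x y z) (hx : r x w)
    (hy : r y w) : r z w := by
  induction h with
  | fst => exact hx
  | snd => exact hy
  | down h _ ih => exact hr.trans h ih
  | triple h _ _ iha ihb => exact hr.closed h iha ihb

theorem singleton (hR : IsFusion R) (w : W) :
    Network R (fun x y => x = base w ∧ y = base w) where
  dom_left h := ⟨h.1, h.1⟩
  dom_right h := ⟨h.2, h.2⟩
  trans h h' := ⟨h.1, h'.2⟩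
  antisymm h h' := h.1.trans h'.1.symm
  lab_mono h := by rw [h.1, h.2]
  fork h := by simp at h
  join h := by simp at h
  mid h := by simp at h
  closed h ha hb := by cases h <;> simp at ha
  fusion _ hx hy := by
    rw [hx.1, hx.2, hy.1]
    exact hR.of_le le_rfl

/-- Membership in `Cl` has a finite derivation, so it already holds in one member of the chain;
every other condition involves finitely many pairs. -/
theorem iUnion_chain {c : Set (Node W → Node W → Prop)} (hc : ∀ r ∈ c, Network R r)
    (hchain : IsChain (· ≤ ·) c) (hne : c.Nonempty) :
    Network R (fun x y => ∃ r ∈ c, r x y) := by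
  have join₂ : ∀ {r₁ r₂}, r₁ ∈ c → r₂ ∈ c → ∃ r ∈ c, r₁ ≤ r ∧ r₂ ≤ r := fun h₁ h₂ =>
    hchain.directedOn _ h₁ _ h₂
  have hcl : ∀ {x y z}, Cl (fun x y => ∃ r ∈ c, r x y) x y z → ∃ r ∈ c, Cl r x y z := by
    intro x y z h
    induction h with
    | fst => exact ⟨_, hne.some_mem, .fst⟩
    | snd => exact ⟨_, hne.some_mem, .snd⟩
    | down h _ ih =>
      obtain ⟨r₁, h₁, h⟩ := h
      obtain ⟨r₂, h₂, ih⟩ := ih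
      obtain ⟨r, hr, hr₁, hr₂⟩ := join₂ h₁ h₂
      exact ⟨r, hr, .down (hr₁ _ _ h) (ih.mono hr₂)⟩
    | triple h _ _ iha ihb =>
      obtain ⟨r₁, h₁, iha⟩ := iha
      obtain ⟨r₂, h₂, ihb⟩ := ihb
      obtain ⟨r, hr, hr₁, hr₂⟩ := join₂ h₁ h₂
      exact ⟨r, hr, .triple h (iha.mono hr₁) (ihb.mono hr₂)⟩
  refine ⟨?_, ?_, ?_, ?_, ?_, ?_, ?_, ?_, ?_, ?_⟩
  · rintro x y ⟨r, hr, h⟩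
    exact ⟨r, hr, (hc r hr).dom_left h⟩
  · rintro x y ⟨r, hr, h⟩
    exact ⟨r, hr, (hc r hr).dom_right h⟩
  · rintro x y z ⟨r₁, h₁, hx⟩ ⟨r₂, h₂, hy⟩
    obtain ⟨r, hr, hr₁, hr₂⟩ := join₂ h₁ h₂
    exact ⟨r, hr, (hc r hr).trans (hr₁ _ _ hx) (hr₂ _ _ hy)⟩
  · rintro x y ⟨r₁, h₁, hx⟩ ⟨r₂, h₂, hy⟩
    obtain ⟨r, hr, hr₁, hr₂⟩ := join₂ h₁ h₂
    exact (hc r hr).antisymm (hr₁ _ _ hx) (hr₂ _ _ hy)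
  · rintro x y ⟨r, hr, h⟩
    exact (hc r hr).lab_mono h
  · rintro q t u (⟨r, hr, h⟩ | ⟨r, hr, h⟩)
    · exact ⟨⟨r, hr, ((hc r hr).fork (.inl h)).1⟩, ⟨r, hr, ((hc r hr).fork (.inl h)).2⟩⟩
    · exact ⟨⟨r, hr, ((hc r hr).fork (.inr h)).1⟩, ⟨r, hr, ((hc r hr).fork (.inr h)).2⟩⟩
  · rintro q t u (⟨r, hr, h⟩ | ⟨r, hr, h⟩)
    · exact ⟨⟨r, hr, ((hc r hr).join (.inl h)).1⟩, ⟨r, hr, ((hc r hr).join (.inl h)).2⟩⟩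
    · exact ⟨⟨r, hr, ((hc r hr).join (.inr h)).1⟩, ⟨r, hr, ((hc r hr).join (.inr h)).2⟩⟩
  · rintro q x y ⟨r, hr, h⟩
    obtain ⟨h₁, h₂, h₃⟩ := (hc r hr).mid h
    exact ⟨⟨r, hr, h₁⟩, ⟨r, hr, h₂⟩, ⟨r, hr, h₃⟩⟩
  · rintro q a b x h ⟨r₁, h₁, ha⟩ ⟨r₂, h₂, hb⟩
    obtain ⟨r, hr, hr₁, hr₂⟩ := join₂ h₁ h₂
    exact ⟨r, hr, (hc r hr).closed h (hr₁ _ _ ha) (hr₂ _ _ hb)⟩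
  · rintro x y z h ⟨r₁, h₁, hx⟩ ⟨r₂, h₂, hy⟩
    obtain ⟨r₃, h₃, h⟩ := hcl h
    obtain ⟨r', hr', hr₁, hr₂⟩ := join₂ h₁ h₂
    obtain ⟨r, hr, hr'r, hr₃⟩ := join₂ hr' h₃
    exact (hc r hr).fusion (h.mono hr₃) (hr'r _ _ (hr₁ _ _ hx)) (hr'r _ _ (hr₂ _ _ hy))

/-! ### Spoiling unwanted minimal upper bounds -/

/-- The network `r` with `mid q x y` inserted just below `q`. -/
def insertMid (r : Node W → Node W → Prop) (q x y : Node W) (a b : Node W) : Prop :=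
  r a b ∨ (b = .mid q x y ∧ (a = .mid q x y ∨ Cl r x y a)) ∨ (a = .mid q x y ∧ r q b)

/-- Strictly below the new point lies exactly `Cl r x y`. Collapsing the new point to `q` preserves
order and labels, so the label conditions are inherited from `r`. -/
theorem network_insertMid (hr : Network R r) {q x y : Node W} (hx : r x q) (hy : r y q)
    (hn : ¬ R (lab q) (lab x) (lab y)) (hc : ¬ r (.mid q x y) (.mid q x y)) :
    Network R (insertMid r q x y) := by
  have hq : r q q := hr.dom_right hx
  have hS : ∀ {a}, Cl r x y a → r a q := fun h => hr.le_of_cl h hx hy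
  -- The failure of `R` enters only here. With `q` outside the generated lower set, transitivity and
  -- antisymmetry hold around the new point.
  have hqS : ¬ Cl r x y q := fun h => hn (hr.fusion h hx hy)
  have hold : ∀ {a}, a ≠ .mid q x y → insertMid r q x y a a → r a a := by
    rintro a ha (h | ⟨h, -⟩ | ⟨h, -⟩)
    exacts [h, absurd h ha, absurd h ha]
  have hl : ∀ {a}, ¬ r a (.mid q x y) := fun h => hc (hr.dom_right h)
  have hl' : ∀ {a}, ¬ r (.mid q x y) a := fun h => hc (hr.dom_left h)
  have dom_left : ∀ {a b}, insertMid r q x y a b → insertMid r q x y a a := by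
    rintro a b (h | ⟨rfl, rfl | h⟩ | ⟨rfl, h⟩)
    · exact .inl (hr.dom_left h)
    · exact .inr (.inl ⟨rfl, .inl rfl⟩)
    · exact .inl (hr.dom_left (hS h))
    · exact .inr (.inl ⟨rfl, .inl rfl⟩)
  have trip : ∀ {p a b z}, Triple p a b → insertMid r q x y a z →
      r a p ∧ r b p ∧ a ≠ .mid q x y ∧ b ≠ .mid q x y ∧ p ≠ .mid q x y := by
    intro p a b z h ha
    have ha' : a ≠ .mid q x y := by cases h <;> simp
    have h' := hr.triple_dom h (hold ha' (dom_left ha))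
    refine ⟨h'.1, h'.2, ha', ?_, ?_⟩ <;> rintro rfl
    exacts [hl' h'.2, hl h'.1]
  have htrans : ∀ {a b c}, insertMid r q x y a b → insertMid r q x y b c →
      insertMid r q x y a c := by
    rintro a b c (h | ⟨rfl, rfl | h⟩ | ⟨rfl, h⟩) (h' | ⟨rfl, h₁ | h'⟩ | ⟨h₀, h'⟩)
    · exact .inl (hr.trans h h')
    · exact absurd (h₁ ▸ h) hl
    · exact .inr (.inl ⟨rfl, .inr (.down h h')⟩)
    · exact absurd (h₀ ▸ h) hl
    · exact absurd h' hl'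
    · exact .inr (.inl ⟨rfl, .inl rfl⟩)
    · exact .inr (.inl ⟨rfl, .inl rfl⟩)
    · exact .inr (.inr ⟨rfl, h'⟩)
    · exact absurd h' hl'
    · exact .inr (.inl ⟨rfl, .inr h⟩)
    · exact .inr (.inl ⟨rfl, .inr h⟩)
    · exact .inl (hr.trans (hS h) h')
    · exact .inr (.inr ⟨rfl, hr.trans h h'⟩)
    · exact absurd (h₁ ▸ h) hl
    · exact absurd (Cl.down h h') hqS
    · exact absurd (h₀ ▸ h) hl
  classical
  let π : Node W → Node W := fun a => if a = .mid q x y then q else a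
  have hπc : π (.mid q x y) = q := if_pos rfl
  have hπ : ∀ {a}, a ≠ .mid q x y → π a = a := fun h => if_neg h
  have hπlab : ∀ a, lab (π a) = lab a := by
    intro a
    by_cases h : a = .mid q x y
    · rw [h, hπc]; rfl
    · rw [hπ h]
  have hπr : ∀ {a b}, insertMid r q x y a b → r (π a) (π b) := by
    rintro a b (h | ⟨rfl, rfl | h⟩ | ⟨rfl, h⟩)
    · rw [hπ, hπ]
      · exact h
      · rintro rfl; exact hl h
      · rintro rfl; exact hl' h
    · rwa [hπc]
    · rw [hπc, hπ]
      · exact hS h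
      · rintro rfl; exact hl' (hS h)
    · rw [hπc, hπ]
      · exact h
      · rintro rfl; exact hl h
  have hdomCl : ∀ {a b z}, insertMid r q x y a a → insertMid r q x y b b →
      Cl (insertMid r q x y) a b z →
      insertMid r q x y z z ∧ Cl r (π a) (π b) (π z) := by
    intro a b z ha hb h
    induction h with
    | fst => exact ⟨ha, .fst⟩
    | snd => exact ⟨hb, .snd⟩
    | down h _ ih => exact ⟨dom_left h, .down (hπr h) ih.2⟩
    | triple h _ _ iha ihb =>
      obtain ⟨h₁, h₂, h₃, h₄, h₅⟩ := trip h iha.1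
      rw [hπ h₃] at iha
      rw [hπ h₄] at ihb
      rw [hπ h₅]
      exact ⟨.inl (hr.dom_right h₁), .triple h iha.2 ihb.2⟩
  refine ⟨dom_left, ?_, htrans, ?_, ?_, ?_, ?_, ?_, ?_, ?_⟩
  · rintro a b (h | ⟨rfl, h⟩ | ⟨rfl, h⟩)
    · exact .inl (hr.dom_right h)
    · exact .inr (.inl ⟨rfl, .inl rfl⟩)
    · exact .inl (hr.dom_right h)
  · rintro a b (h | ⟨rfl, rfl | h⟩ | ⟨rfl, h⟩) (h' | ⟨h₀, h'⟩ | ⟨h₀, h'⟩)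
    · exact hr.antisymm h h'
    · exact absurd (h₀ ▸ h) hl'
    · exact absurd (h₀ ▸ h) hl
    · rfl
    · rfl
    · rfl
    · exact absurd h' hl'
    · exact h₀
    · exact absurd (.down h' h) hqS
    · exact absurd h' hl
    · rcases h' with h' | h'
      · exact h'.symm
      · exact absurd (.down h h') hqS
    · exact h₀.symm
  · intro a b h
    have := hr.lab_mono (hπr h)
    rwa [hπlab, hπlab] at this
  · intro p t u h
    have := hr.fork (h.imp (hold (by simp)) (hold (by simp)))
    exact ⟨.inl this.1, .inl this.2⟩
  · intro p t u h
    have := hr.join (h.imp (hold (by simp)) (hold (by simp)))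
    exact ⟨.inl this.1, .inl this.2⟩
  · intro p a b h
    by_cases heq : Node.mid p a b = .mid q x y
    · cases heq
      exact ⟨.inr (.inl ⟨rfl, .inr .fst⟩), .inr (.inl ⟨rfl, .inr .snd⟩), .inr (.inr ⟨rfl, hq⟩)⟩
    · obtain ⟨h₁, h₂, h₃⟩ := hr.mid (hold heq h)
      exact ⟨.inl h₁, .inl h₂, .inl h₃⟩
  · intro p a b z h ha hb
    obtain ⟨h₁, h₂, h₃, h₄, h₅⟩ := trip h ha
    by_cases hz : z = .mid q x y
    · subst hz
      have hcl : ∀ {d}, d ≠ .mid q x y → insertMid r q x y d (.mid q x y) → Cl r x y d := by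
        rintro d hd (h | ⟨-, h | h⟩ | ⟨h, -⟩)
        exacts [absurd h hl, absurd h hd, h, absurd h hd]
      exact .inr (.inl ⟨rfl, .inr (.triple h (hcl h₃ ha) (hcl h₄ hb))⟩)
    · have ha := hπr ha
      have hb := hπr hb
      rw [hπ h₃, hπ hz] at ha
      rw [hπ h₄, hπ hz] at hb
      exact .inl (hr.closed h ha hb)
  · intro a b z h ha hb
    have := hr.fusion (hdomCl (dom_left ha) (dom_left hb) h).2 (hπr ha) (hπr hb)
    rwa [hπlab, hπlab, hπlab] at this

/-! ### Realising decompositions of a point -/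

/-- The network `r` with `left q t u` and `right q t u` added below `q`. -/
def insertFork (r : Node W → Node W → Prop) (q : Node W) (t u : W) (a b : Node W) : Prop :=
  r a b ∨ ((a = .left q t u ∨ a = .right q t u) ∧ (r q b ∨ b = a))

/-- Both feet are minimal and everything else above them is above `q`. For `fusion`, two old points
reduce to `r`; the two feet generate, of the points above both, only `q`, where `hs` applies; a foot
generates nothing but itself; and a foot with an old point is bounded within the closure only by the
old point. -/
theorem network_insertFork (hr : Network R r) (hR : IsFusion R) {q : Node W} {t u : W}
    (hq : r q q) (hs : R (lab q) t u) (hc : ¬ r (.left q t u) (.left q t u)) :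
    Network R (insertFork r q t u) := by
  set New : Node W → Prop := fun a => a = .left q t u ∨ a = .right q t u with hNew
  have hc' : ∀ {a}, New a → ¬ r a a := by
    rintro a (rfl | rfl) h
    exacts [hc h, hc (hr.dom_left (hr.fork (.inr h)).1)]
  have hl : ∀ {a b}, r a b → ¬ New a := fun h hn => hc' hn (hr.dom_left h)
  have hl' : ∀ {a b}, r a b → ¬ New b := fun h hn => hc' hn (hr.dom_right h)
  have hnlab : ∀ {a}, New a → lab a ≤ lab q := by
    rintro a (rfl | rfl)
    exacts [hR.le_left hs, hR.le_right hs]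
  have hold : ∀ {a b}, ¬ New a → insertFork r q t u a b → r a b := by
    rintro a b ha (h | ⟨h, -⟩)
    exacts [h, absurd h ha]
  have hnew : ∀ {a}, New a → insertFork r q t u a a := fun h => .inr ⟨h, .inr rfl⟩
  have hnew_le : ∀ {a b}, New a → insertFork r q t u a b → r q b ∨ b = a := by
    rintro a b ha (h | ⟨-, h⟩)
    exacts [absurd ha (hl h), h]
  have hle_new : ∀ {a b}, New b → insertFork r q t u a b → a = b := by
    rintro a b hb (h | ⟨-, h | h⟩)
    exacts [absurd hb (hl' h), absurd hb (hl' h), h.symm]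
  have dom_left : ∀ {a b}, insertFork r q t u a b → insertFork r q t u a a := by
    rintro a b (h | ⟨h, -⟩)
    exacts [.inl (hr.dom_left h), hnew h]
  have trip : ∀ {p a b}, Triple p a b → insertFork r q t u a a →
      (p = q ∧ a = .left q t u ∧ b = .right q t u) ∨ (r a p ∧ r b p) := by
    rintro p a b h (ha | ⟨ha, -⟩)
    · exact .inr (hr.triple_dom h ha)
    · cases h with
      | fork t' u' =>
        rcases ha with ha | ha <;> cases ha
        exact .inl ⟨rfl, rfl, rfl⟩
      | join s t' => rcases ha with ha | ha <;> cases ha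
  have trans : ∀ {a b c}, insertFork r q t u a b → insertFork r q t u b c →
      insertFork r q t u a c := by
    intro a b c h h'
    by_cases ha : New a
    · rcases hnew_le ha h with h | rfl
      · exact .inr ⟨ha, .inl (hr.trans h (hold (hl' h) h'))⟩
      · exact h'
    · have h := hold ha h
      exact .inl (hr.trans h (hold (hl' h) h'))
  have antisymm : ∀ {a b}, insertFork r q t u a b → insertFork r q t u b a → a = b := by
    intro a b h h'
    by_cases ha : New a
    · exact (hle_new ha h').symm
    by_cases hb : New b
    · exact hle_new hb h
    exact hr.antisymm (hold ha h) (hold hb h')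
  have lab_mono : ∀ {a b}, insertFork r q t u a b → lab a ≤ lab b := by
    rintro a b (h | ⟨h, h' | rfl⟩)
    exacts [hr.lab_mono h, (hnlab h).trans (hr.lab_mono h'), le_rfl]
  have closed : ∀ {p a b x}, Triple p a b → insertFork r q t u a x → insertFork r q t u b x →
      insertFork r q t u p x := by
    intro p a b x h ha hb
    rcases trip h (dom_left ha) with ⟨rfl, rfl, rfl⟩ | ⟨h₁, h₂⟩
    · rcases hnew_le (.inl rfl) ha with ha | rfl
      · exact .inl ha
      · exact absurd (hle_new (.inl rfl) hb) (by simp)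
    · exact .inl (hr.closed h (hold (hl h₁) ha) (hold (hl h₂) hb))
  have hmixed : ∀ {x y z}, New x → r y y → Cl (insertFork r q t u) x y z →
      insertFork r q t u x z → insertFork r q t u y z → R (lab z) (lab x) (lab y) := by
    intro x y z hx hy h hxz hyz
    have hz : z = x ∨ insertFork r q t u z y := by
      clear hxz hyz
      induction h with
      | fst => exact .inl rfl
      | snd => exact .inr (.inl hy)
      | down h _ ih =>
        rcases ih with rfl | ih
        · exact .inl (hle_new hx h)
        · exact .inr (trans h ih)
      | @triple p a b h _ _ iha ihb =>
        have hle : ∀ {a}, New a → insertFork r q t u a y → insertFork r q t u q y := by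
          intro a ha h
          rcases hnew_le ha h with h | rfl
          exacts [.inl h, absurd ha (hl hy)]
        have hdom : insertFork r q t u a a := by
          rcases iha with rfl | h
          exacts [hnew hx, dom_left h]
        -- The feet are distinct, so one of them is not `x` and lies below the old point `y`; then
        -- `q` lies below `y` as well.
        rcases trip h hdom with ⟨rfl, rfl, rfl⟩ | ⟨h₁, h₂⟩
        · rcases iha with rfl | ha
          · rcases ihb with hb | hb
            · cases hb
            · exact .inr (hle (.inr rfl) hb)
          · exact .inr (hle (.inl rfl) ha)
        · rcases iha with rfl | ha
          · exact absurd hx (hl h₁)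
          rcases ihb with rfl | hb
          · exact absurd hx (hl h₂)
          exact .inr (closed h ha hb)
    rcases hz with rfl | hz
    · exact absurd (hle_new hx hyz ▸ hx) (hl hy)
    · obtain rfl := antisymm hz hyz
      exact hR.symm (hR.of_le (lab_mono hxz))
  classical
  -- This collapse preserves order but not labels, so it yields `fusion` directly only for pairs of
  -- old points.
  let π : Node W → Node W := fun a => if New a then q else a
  have hπn : ∀ {a}, New a → π a = q := fun h => if_pos h
  have hπ : ∀ {a}, ¬ New a → π a = a := fun h => if_neg h
  have hπr : ∀ {a b}, insertFork r q t u a b → r (π a) (π b) := by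
    rintro a b (h | ⟨ha, h | rfl⟩)
    · rwa [hπ (hl h), hπ (hl' h)]
    · rwa [hπn ha, hπ (hl' h)]
    · rwa [hπn ha]
  have hcl : ∀ {x y z}, insertFork r q t u x x → insertFork r q t u y y →
      Cl (insertFork r q t u) x y z →
      insertFork r q t u z z ∧ Cl r (π x) (π y) (π z) := by
    intro x y z hx hy h
    induction h with
    | fst => exact ⟨hx, .fst⟩
    | snd => exact ⟨hy, .snd⟩
    | down h _ ih => exact ⟨dom_left h, .down (hπr h) ih.2⟩
    | triple h _ _ iha ihb =>
      rcases trip h iha.1 with ⟨rfl, rfl, rfl⟩ | ⟨h₁, h₂⟩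
      · refine ⟨.inl hq, ?_⟩
        rw [hπ (hl hq)]
        exact hπn (.inl rfl) ▸ iha.2
      · rw [hπ (hl h₁)] at iha
        rw [hπ (hl h₂)] at ihb
        rw [hπ (hl' h₁)]
        exact ⟨.inl (hr.dom_right h₁), .triple h iha.2 ihb.2⟩
  have hpair : ∀ {x y z}, x = .left q t u → y = .right q t u →
      Cl (insertFork r q t u) x y z → insertFork r q t u x z → insertFork r q t u y z →
      R (lab z) (lab x) (lab y) := by
    rintro x y z rfl rfl h hxz hyz
    have hcl := (hcl (hnew (.inl rfl)) (hnew (.inr rfl)) h).2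
    rcases hnew_le (.inl rfl) hxz with hqz | rfl
    · rw [hπn (.inl rfl), hπn (.inr rfl), hπ (hl' hqz)] at hcl
      obtain rfl := hr.antisymm (hr.le_of_cl hcl hq hq) hqz
      exact hs
    · exact absurd (hle_new (.inl rfl) hyz) (by simp)
  have hsame : ∀ {x z}, New x → Cl (insertFork r q t u) x x z → R (lab z) (lab x) (lab x) := by
    intro x z hx h
    obtain rfl : z = x := by
      induction h with
      | fst => rfl
      | snd => rfl
      | down h _ ih => exact hle_new hx (ih ▸ h)
      | triple h _ _ iha ihb => cases h <;> cases iha.trans ihb.symm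
    exact hR.of_le le_rfl
  refine ⟨dom_left, ?_, trans, antisymm, lab_mono, ?_, ?_, ?_, closed, ?_⟩
  · rintro a b (h | ⟨h, h' | rfl⟩)
    exacts [.inl (hr.dom_right h), .inl (hr.dom_right h'), hnew h]
  · intro p t' u' h
    by_cases hp : New (.left p t' u')
    · rcases hp with hp | hp <;> cases hp
      exact ⟨.inr ⟨.inl rfl, .inl hq⟩, .inr ⟨.inr rfl, .inl hq⟩⟩
    · have hp' : ¬ New (.right p t' u') := by
        rintro (hp' | hp') <;> cases hp'
        exact hp (.inl rfl)
      have := hr.fork (h.imp (hold hp) (hold hp'))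
      exact ⟨.inl this.1, .inl this.2⟩
  · intro p s' t' h
    have := hr.join (h.imp (hold (by simp [hNew])) (hold (by simp [hNew])))
    exact ⟨.inl this.1, .inl this.2⟩
  · intro p a b h
    obtain ⟨h₁, h₂, h₃⟩ := hr.mid (hold (by simp [hNew]) h)
    exact ⟨.inl h₁, .inl h₂, .inl h₃⟩
  · intro x y z h hxz hyz
    by_cases hx : New x <;> by_cases hy : New y
    · rcases id hx with hx' | hx' <;> rcases id hy with hy' | hy'
      · obtain rfl := hx'.trans hy'.symm
        exact hsame hx h
      · exact hpair hx' hy' h hxz hyz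
      · exact hR.symm (hpair hy' hx' h.symm hyz hxz)
      · obtain rfl := hx'.trans hy'.symm
        exact hsame hx h
    · exact hmixed hx (hr.dom_left (hold hy hyz)) h hxz hyz
    · exact hR.symm (hmixed hy (hr.dom_left (hold hx hxz)) h.symm hyz hxz)
    · have h := (hcl (dom_left hxz) (dom_left hyz) h).2
      have hxz := hold hx hxz
      rw [hπ hx, hπ hy, hπ (hl' hxz)] at h
      exact hr.fusion h hxz (hold hy hyz)

/-! ### Realising triples for the residual -/

/-- The network `r` with a new supremum `join u s t` of `side u s t` and `u`. -/
def insertJoin (r : Node W → Node W → Prop) (u : Node W) (s t : W) (a b : Node W) : Prop :=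
  r a b ∨ (a = .side u s t ∧ b = .side u s t) ∨
    (b = .join u s t ∧ (r a u ∨ a = .side u s t ∨ a = .join u s t))

/-- The new supremum is maximal and the side point is minimal. Old points generate only old points,
so the one substantial case of `fusion` is the side point paired with some `y` and bounded by the
new supremum. -/
theorem network_insertJoin (hr : Network R r) (hR : IsFusion R) {u : Node W} {s t : W}
    (hu : r u u) (hs : R s t (lab u)) (hc : ¬ r (.side u s t) (.side u s t)) :
    Network R (insertJoin r u s t) := by
  set T : Node W := .side u s t with hT
  set J : Node W := .join u s t with hJ
  have hTJ : T ≠ J := by simp [hT, hJ]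
  have hcJ : ¬ r J J := fun h => hc (hr.dom_left (hr.join (.inr h)).1)
  have hneT : ∀ {a}, r a a → a ≠ T := by rintro a h rfl; exact hc h
  have hneJ : ∀ {a}, r a a → a ≠ J := by rintro a h rfl; exact hcJ h
  have hold : ∀ {a b}, r b b → insertJoin r u s t a b → r a b := by
    rintro a b hb (h | ⟨-, h⟩ | ⟨h, -⟩)
    exacts [h, absurd h (hneT hb), absurd h (hneJ hb)]
  have hdom : ∀ {a}, a ≠ T → a ≠ J → insertJoin r u s t a a → r a a := by
    rintro a hT hJ (h | ⟨h, -⟩ | ⟨h, -⟩)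
    exacts [h, absurd h hT, absurd h hJ]
  have hTT : insertJoin r u s t T T := .inr (.inl ⟨rfl, rfl⟩)
  have hTJ' : insertJoin r u s t T J := .inr (.inr ⟨rfl, .inr (.inl rfl)⟩)
  have hJJ : insertJoin r u s t J J := .inr (.inr ⟨rfl, .inr (.inr rfl)⟩)
  have huJ : insertJoin r u s t u J := .inr (.inr ⟨rfl, .inl hu⟩)
  have hle_T : ∀ {a}, insertJoin r u s t a T → a = T := by
    rintro a (h | ⟨h, -⟩ | ⟨h, -⟩)
    exacts [absurd (hr.dom_right h) hc, h, absurd h hTJ]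
  have hJ_le : ∀ {a}, insertJoin r u s t J a → a = J := by
    rintro a (h | ⟨h, -⟩ | ⟨h, -⟩)
    exacts [absurd (hr.dom_left h) hcJ, absurd h.symm hTJ, h]
  have hT_le : ∀ {a}, insertJoin r u s t T a → a = T ∨ a = J := by
    rintro a (h | ⟨-, h⟩ | ⟨h, -⟩)
    exacts [absurd (hr.dom_left h) hc, .inl h, .inr h]
  have dom_left : ∀ {a b}, insertJoin r u s t a b → insertJoin r u s t a a := by
    rintro a b (h | ⟨rfl, -⟩ | ⟨-, h | rfl | rfl⟩)
    exacts [.inl (hr.dom_left h), hTT, .inl (hr.dom_left h), hTT, hJJ]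
  have dom_right : ∀ {a b}, insertJoin r u s t a b → insertJoin r u s t b b := by
    rintro a b (h | ⟨-, rfl⟩ | ⟨rfl, -⟩)
    exacts [.inl (hr.dom_right h), hTT, hJJ]
  have trans : ∀ {a b c}, insertJoin r u s t a b → insertJoin r u s t b c →
      insertJoin r u s t a c := by
    rintro a b c h (h' | ⟨rfl, rfl⟩ | ⟨rfl, h' | rfl | rfl⟩)
    · exact .inl (hr.trans (hold (hr.dom_left h') h) h')
    · exact h
    · exact .inr (.inr ⟨rfl, .inl (hr.trans (hold (hr.dom_left h') h) h')⟩)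
    · rw [hle_T h]
      exact hTJ'
    · exact h
  have antisymm : ∀ {a b}, insertJoin r u s t a b → insertJoin r u s t b a → a = b := by
    rintro a b h (h' | ⟨rfl, rfl⟩ | ⟨rfl, h' | rfl | rfl⟩)
    · exact hr.antisymm (hold (hr.dom_left h') h) h'
    · rfl
    · exact (hJ_le h).symm
    · exact (hJ_le h).symm
    · rfl
  have lab_mono : ∀ {a b}, insertJoin r u s t a b → lab a ≤ lab b := by
    rintro a b (h | ⟨rfl, rfl⟩ | ⟨rfl, h | rfl | rfl⟩)
    exacts [hr.lab_mono h, le_rfl, (hr.lab_mono h).trans (hR.le_right hs), hR.le_left hs, le_rfl]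
  have trip : ∀ {p a b}, Triple p a b → insertJoin r u s t a a →
      (p = J ∧ a = T ∧ b = u) ∨ (r a p ∧ r b p) := by
    intro p a b h ha
    by_cases haT : a = T
    · rw [hT] at haT
      cases h <;> cases haT
      exact .inl ⟨rfl, rfl, rfl⟩
    · have haJ : a ≠ J := by cases h <;> simp [hJ]
      exact .inr (hr.triple_dom h (hdom haT haJ ha))
  have closed : ∀ {p a b x}, Triple p a b → insertJoin r u s t a x → insertJoin r u s t b x →
      insertJoin r u s t p x := by
    intro p a b x h ha hb
    rcases trip h (dom_left ha) with ⟨rfl, rfl, rfl⟩ | ⟨h₁, h₂⟩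
    · rcases hT_le ha with rfl | rfl
      · exact absurd (hle_T hb) (hneT hu)
      · exact hJJ
    · rcases ha with ha | ⟨rfl, -⟩ | ⟨rfl, ha | rfl | rfl⟩
      · exact .inl (hr.closed h ha (hold (hr.dom_right ha) hb))
      · exact absurd (hr.dom_left h₁) hc
      · rcases hb with hb | ⟨rfl, -⟩ | ⟨-, hb | rfl | rfl⟩
        · exact absurd (hr.dom_right hb) hcJ
        · exact absurd (hr.dom_left h₂) hc
        · exact .inr (.inr ⟨rfl, .inl (hr.closed h ha hb)⟩)
        · exact absurd (hr.dom_left h₂) hc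
        · exact absurd (hr.dom_left h₂) hcJ
      · exact absurd (hr.dom_left h₁) hc
      · exact absurd (hr.dom_left h₁) hcJ
  have hcl : ∀ {x y z}, r x x → r y y → Cl (insertJoin r u s t) x y z → r z z ∧ Cl r x y z := by
    intro x y z hx hy h
    induction h with
    | fst => exact ⟨hx, .fst⟩
    | snd => exact ⟨hy, .snd⟩
    | down h _ ih =>
      have h := hold ih.1 h
      exact ⟨hr.dom_left h, .down h ih.2⟩
    | triple h _ _ iha ihb =>
      exact ⟨hr.dom_right (hr.triple_dom h iha.1).1, .triple h iha.2 ihb.2⟩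
  -- Unless `u` lies below `y`, the new triple never fires, and the closure stays within the side
  -- point and the lower set of `y`.
  have hside : ∀ {y}, insertJoin r u s t y y → Cl (insertJoin r u s t) T y J →
      insertJoin r u s t u y := by
    intro y hy h
    by_contra hn
    have hz : ∀ {z}, Cl (insertJoin r u s t) T y z → z = T ∨ insertJoin r u s t z y := by
      intro z h
      induction h with
      | fst => exact .inl rfl
      | snd => exact .inr hy
      | down h _ ih =>
        rcases ih with rfl | ih
        exacts [.inl (hle_T h), .inr (trans h ih)]
      | @triple p a b h _ _ iha ihb =>
        have hdom : insertJoin r u s t a a := by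
          rcases iha with rfl | h
          exacts [hTT, dom_left h]
        rcases trip h hdom with ⟨rfl, rfl, rfl⟩ | ⟨h₁, h₂⟩
        · rcases ihb with hb | hb
          exacts [absurd hb (hneT hu), absurd hb hn]
        · rcases iha with rfl | ha
          · exact absurd (hr.dom_left h₁) hc
          rcases ihb with rfl | hb
          · exact absurd (hr.dom_left h₂) hc
          exact .inr (closed h ha hb)
    rcases hz h with h | h
    · exact hTJ h.symm
    · exact hn (trans huJ h)
  have hsideR : ∀ {y}, insertJoin r u s t y J → Cl (insertJoin r u s t) T y J →
      R s t (lab y) := by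
    intro y hy h
    have huy := hside (dom_left hy) h
    rcases hy with hy | ⟨-, hy⟩ | ⟨-, hy | rfl | rfl⟩
    · exact absurd (hr.dom_right hy) hcJ
    · exact absurd hy.symm hTJ
    -- Here `u ≤ y ≤ u`, so `y` is `u` and the requested triple `hs` applies.
    · rw [← hr.antisymm (hold (hr.dom_left hy) huy) hy]
      exact hs
    · exact absurd (hle_T huy) (hneT hu)
    · exact hR.symm (hR.of_le (hR.le_left hs))
  refine ⟨dom_left, dom_right, trans, antisymm, lab_mono, ?_, ?_, ?_, closed, ?_⟩
  · intro p t' u' h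
    have := hr.fork (h.imp (hdom (by simp [hT]) (by simp [hJ])) (hdom (by simp [hT]) (by simp [hJ])))
    exact ⟨.inl this.1, .inl this.2⟩
  · intro p s' t' h
    by_cases hp : Node.side p s' t' = T
    · rw [hT] at hp
      cases hp
      exact ⟨hTJ', huJ⟩
    · have hp' : Node.join p s' t' ≠ J := by
        intro h
        rw [hJ] at h
        cases h
        exact hp rfl
      have := hr.join (h.imp (hdom hp (by simp [hJ])) (hdom (by simp [hT]) hp'))
      exact ⟨.inl this.1, .inl this.2⟩
  · intro p a b h
    obtain ⟨h₁, h₂, h₃⟩ := hr.mid (hdom (by simp [hT]) (by simp [hJ]) h)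
    exact ⟨.inl h₁, .inl h₂, .inl h₃⟩
  · intro x y z h hx hy
    rcases id hx with hx' | ⟨rfl, rfl⟩ | ⟨rfl, hx' | rfl | rfl⟩
    · have hy := hold (hr.dom_right hx') hy
      exact hr.fusion (hcl (hr.dom_left hx') (hr.dom_left hy) h).2 hx' hy
    · rw [hle_T hy]
      exact hR.of_le le_rfl
    · rcases id hy with hy' | ⟨rfl, h'⟩ | ⟨-, hy' | rfl | rfl⟩
      · exact absurd (hr.dom_right hy') hcJ
      · exact absurd h'.symm hTJ
      · exact absurd (hcl (hr.dom_left hx') (hr.dom_left hy') h).1 hcJ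
      · exact hR.symm (hsideR hx h.symm)
      · exact hR.symm (hR.of_le (lab_mono hx))
    · exact hsideR hy h
    · exact hR.of_le (lab_mono hy)

/-! ### The representing poset as a maximal network -/

theorem exists_maximal (hR : IsFusion R) (w : W) :
    ∃ r, Maximal (Network R) r ∧ r (base w) (base w) := by
  obtain ⟨r, hle, hmax⟩ := zorn_le_nonempty₀ {r | Network R r}
    (fun c hc hchain r₀ hr₀ => ⟨_, iUnion_chain hc hchain ⟨r₀, hr₀⟩,
      fun r hr x y h => ⟨r, hr, h⟩⟩) _ (singleton hR w)
  exact ⟨r, hmax, hle _ _ ⟨rfl, rfl⟩⟩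

end Network

/-- Every fusion relation is the image, under a bounded morphism for both readings (and for the
residual), of a poset with a point over a prescribed point. -/
theorem IsFusion.exists_poset {W : Type u} [Preorder W] {R : W → W → W → Prop}
    (hR : IsFusion R) (w : W) :
    ∃ (Q : Type u) (_ : PartialOrder Q) (f : Q → W), (∃ q, f q = w) ∧
      (∀ q a b, IsMub q a b → R (f q) (f a) (f b)) ∧
      (∀ q t u, R (f q) t u → ∃ a b, f a = t ∧ f b = u ∧ IsSup q a b) ∧
      (∀ b s t, R s t (f b) → ∃ q a, f q = s ∧ f a = t ∧ IsSup q a b) := by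
  obtain ⟨r, hmax, hw⟩ := Network.exists_maximal hR w
  have hr := hmax.prop
  let Q : PartialOrder {x // r x x} :=
    { le := fun a b => r a b
      le_refl := fun a => a.2
      le_trans := fun _ _ _ => hr.trans
      le_antisymm := fun _ _ h h' => Subtype.ext (hr.antisymm h h') }
  have hsup : ∀ {q a b : {x // r x x}}, Triple q.1 a.1 b.1 → IsSup q a b := by
    intro q a b h
    have hle := hr.triple_dom h a.2
    refine ⟨?_, fun x hx => hr.closed h (hx (Set.mem_insert _ _)) (hx (Set.mem_insert_of_mem _ rfl))⟩
    rintro x (rfl | rfl)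
    exacts [hle.1, hle.2]
  refine ⟨{x // r x x}, Q, fun x => lab x.1, ⟨⟨_, hw⟩, rfl⟩, ?_, ?_, ?_⟩
  · intro q a b h
    by_contra hn
    have ha : r a.1 q.1 := h.1 (Set.mem_insert _ _)
    have hb : r b.1 q.1 := h.1 (Set.mem_insert_of_mem _ rfl)
    -- By maximality the named point is present already, since otherwise the insertion would give a
    -- strictly larger network. The other two clauses argue alike.
    have hc : r (.mid q.1 a.1 b.1) (.mid q.1 a.1 b.1) := by
      by_contra hc
      exact hc (hmax.le_of_ge (hr.network_insertMid ha hb hn hc) (fun _ _ => .inl) _ _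
        (.inr (.inl ⟨rfl, .inl rfl⟩)))
    obtain ⟨h₁, h₂, h₃⟩ := hr.mid hc
    -- Minimality of `q` places it below `mid q a b`, so the two nodes coincide, although one is a
    -- proper subterm of the other.
    refine mid_ne _ _ _ (hr.antisymm h₃ (h.2 (y := ⟨_, hc⟩) ?_ h₃))
    rintro x (rfl | rfl)
    exacts [h₁, h₂]
  · intro q t u h
    have hc : r (.left q.1 t u) (.left q.1 t u) := by
      by_contra hc
      exact hc (hmax.le_of_ge (hr.network_insertFork hR q.2 h hc) (fun _ _ => .inl) _ _
        (.inr ⟨.inl rfl, .inr rfl⟩))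
    exact ⟨⟨_, hc⟩, ⟨_, hr.dom_left (hr.fork (.inl hc)).2⟩, rfl, rfl, hsup (.fork _ _ _)⟩
  · intro u s t h
    have hc : r (.side u.1 s t) (.side u.1 s t) := by
      by_contra hc
      exact hc (hmax.le_of_ge (hr.network_insertJoin hR u.2 h hc) (fun _ _ => .inl) _ _
        (.inr (.inl ⟨rfl, rfl⟩)))
    exact ⟨⟨_, hr.dom_right (hr.join (.inl hc)).1⟩, ⟨_, hc⟩, rfl, rfl, hsup (.join _ _ _)⟩

/-! ### Transfer of truth and equality of the logics -/

/-- `J.Rel` lies between `IsSup` and `IsMub`. The forth condition is assumed for the weaker of these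
and the lifting conditions give the stronger, which covers both values of `J`. The clause `hres` is
what the residual needs beyond a bounded morphism for `fus`. -/
theorem ResFormula.sat_iff {α : Type v} {I J : Reading} {P Q : Type u} [Preorder P] [Preorder Q]
    (V : α → Set P) (f : Q → P)
    (hforth : ∀ q a b, IsMub q a b → I.Rel (f q) (f a) (f b))
    (hback : ∀ q t u, I.Rel (f q) t u → ∃ a b, f a = t ∧ f b = u ∧ IsSup q a b)
    (hres : ∀ b s t, I.Rel s t (f b) → ∃ q a, f q = s ∧ f a = t ∧ IsSup q a b)
    (φ : ResFormula α) (q : Q) :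
    ResFormula.Sat J (fun p => f ⁻¹' V p) q φ ↔ ResFormula.Sat I V (f q) φ := by
  have hmub : ∀ {q a b : Q}, J.Rel q a b → IsMub q a b := by
    intro q a b h
    cases J
    exacts [h, IsSup.isMub h]
  have hsup : ∀ {q a b : Q}, IsSup q a b → J.Rel q a b := by
    intro q a b h
    cases J
    exacts [h.isMub, h]
  induction φ generalizing q with
  | bot => exact Iff.rfl
  | var p => exact Iff.rfl
  | neg φ ih => exact not_congr (ih q)
  | or φ ψ ihφ ihψ => exact or_congr (ihφ q) (ihψ q)
  | fus φ ψ ihφ ihψ =>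
    constructor
    · rintro ⟨a, b, ha, hb, h⟩
      exact ⟨f a, f b, (ihφ a).1 ha, (ihψ b).1 hb, hforth _ _ _ (hmub h)⟩
    · rintro ⟨t, u, ht, hu, h⟩
      obtain ⟨a, b, rfl, rfl, h'⟩ := hback _ _ _ h
      exact ⟨a, b, (ihφ a).2 ht, (ihψ b).2 hu, hsup h'⟩
  | res φ ψ ihφ ihψ =>
    constructor
    · intro H t s ht h
      obtain ⟨s, a, rfl, rfl, h'⟩ := hres _ _ _ h
      exact (ihψ s).1 (H a s ((ihφ a).2 ht) (hsup h'))
    · intro H a s ha h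
      exact (ihψ s).2 (H (f a) (f s) ((ihφ a).1 ha) (hforth _ _ _ (hmub h)))

/-- The basic language as a fragment of the language with the residual. -/
def Formula.toRes {α : Type v} : Formula α → ResFormula α
  | .bot => .bot
  | .var p => .var p
  | .neg φ => .neg φ.toRes
  | .or φ ψ => .or φ.toRes ψ.toRes
  | .fus φ ψ => .fus φ.toRes ψ.toRes

theorem Formula.sat_toRes {α : Type v} (I : Reading) {P : Type u} [Preorder P]
    (V : α → Set P) (φ : Formula α) (s : P) :
    ResFormula.Sat I V s φ.toRes ↔ Formula.Sat I V s φ := by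
  induction φ generalizing s with
  | bot => exact Iff.rfl
  | var p => exact Iff.rfl
  | neg φ ih => exact not_congr (ih s)
  | or φ ψ ihφ ihψ => exact or_congr (ihφ s) (ihψ s)
  | fus φ ψ ihφ ihψ =>
    exact exists_congr fun t => exists_congr fun u =>
      and_congr (ihφ t) (and_congr (ihψ u) Iff.rfl)

/-- Every pointed model of the reading `I` is equivalent to a pointed poset model of `J`. -/
theorem exists_equiv_model {α : Type v} (I J : Reading) (K : FrameClass) {P : Type u}
    [Preorder P] (V : α → Set P) (s : P) :
    ∃ (Q : Type u) (_ : Preorder Q) (V' : α → Set Q) (q : Q), K.Mem Q ∧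
      ∀ φ, ResFormula.Sat J V' q φ ↔ ResFormula.Sat I V s φ := by
  obtain ⟨Q, hQ, f, ⟨q, rfl⟩, hforth, hback, hres⟩ := (I.isFusion P).exists_poset s
  refine ⟨Q, inferInstance, fun p => f ⁻¹' V p, q, ?_, fun φ =>
    ResFormula.sat_iff V f hforth hback hres φ q⟩
  cases K
  exacts [fun x y => le_antisymm, trivial]

theorem resLogicOf_eq {α : Type v} (I J : Reading) (K L : FrameClass) :
    resLogicOf.{u, v} (α := α) I K = resLogicOf.{u, v} J L := by
  have key : ∀ (I J : Reading) (K L : FrameClass) (Γ : Set (ResFormula α)) (φ : ResFormula α),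
      (resLogicOf.{u, v} I K).consequence Γ φ → (resLogicOf.{u, v} J L).consequence Γ φ := by
    intro I J K L Γ φ h P _ _ V s hs
    -- The model for `J` is replaced by a poset model for `I`; a poset belongs to either class, so
    -- membership of `P` in `L` plays no role.
    obtain ⟨Q, _, V', q, hK, hq⟩ := exists_equiv_model J I K V s
    exact (hq φ).1 (h Q hK V' q fun γ hγ => (hq γ).2 (hs γ hγ))
  have hvalid : ∀ (I : Reading) (K : FrameClass) (φ : ResFormula α),
      φ ∈ (resLogicOf.{u, v} I K).validities ↔ (resLogicOf.{u, v} I K).consequence ∅ φ := by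
    intro I K φ
    exact ⟨fun h P _ hK V s _ => h P hK V s, fun h P _ hK V s => h P hK V s (by simp)⟩
  have hval : (resLogicOf.{u, v} (α := α) I K).validities = (resLogicOf.{u, v} J L).validities := by
    ext φ
    rw [hvalid, hvalid]
    exact ⟨key _ _ _ _ _ _, key _ _ _ _ _ _⟩
  have hcons : (resLogicOf.{u, v} (α := α) I K).consequence =
      (resLogicOf.{u, v} J L).consequence := by
    funext Γ φ
    exact propext ⟨key _ _ _ _ _ _, key _ _ _ _ _ _⟩
  exact congrArg₂ Logic.mk hval hcons

/-- The basic logic is the pullback of the extended one along the embedding of formulas, so the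
first chain of equalities follows from the second. -/
theorem logicOf_eq_comap {α : Type v} (I : Reading) (K : FrameClass) :
    logicOf.{u, v} (α := α) I K =
      ⟨Formula.toRes ⁻¹' (resLogicOf.{u, v} I K).validities,
        fun Γ φ => (resLogicOf.{u, v} I K).consequence (Formula.toRes '' Γ) φ.toRes⟩ := by
  simp only [logicOf, resLogicOf, Set.preimage_ofPred_eq, Set.forall_mem_image, Formula.sat_toRes]

theorem logicOf_eq {α : Type v} (I J : Reading) (K L : FrameClass) :
    logicOf.{u, v} (α := α) I K = logicOf.{u, v} J L := by
  rw [logicOf_eq_comap, logicOf_eq_comap, resLogicOf_eq I J K L]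

end ModalUB

theorem mainTheorem8 (α : Type v) :
    (ModalUB.MINPos.{u, v} α = ModalUB.MINPre.{u, v} α ∧
      ModalUB.MINPre.{u, v} α = ModalUB.MILPre.{u, v} α ∧
      ModalUB.MILPre.{u, v} α = ModalUB.MILPos.{u, v} α) ∧
    (ModalUB.MINPosRes.{u, v} α = ModalUB.MINPreRes.{u, v} α ∧
      ModalUB.MINPreRes.{u, v} α = ModalUB.MILPreRes.{u, v} α ∧
      ModalUB.MILPreRes.{u, v} α = ModalUB.MILPosRes.{u, v} α) :=
  ⟨⟨ModalUB.logicOf_eq _ _ _ _, ModalUB.logicOf_eq _ _ _ _, ModalUB.logicOf_eq _ _ _ _⟩,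
    ModalUB.resLogicOf_eq _ _ _ _, ModalUB.resLogicOf_eq _ _ _ _, ModalUB.resLogicOf_eq _ _ _ _⟩
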